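/- Identify a language $L\subseteq\{0,1\}^*$ with its indicator function, so $L(x)=1$ if $x\in L$ and $L(x)=0$ otherwise. For every $n$ let $\mathcal D_n$ be a probability distribution on $\{0,1\}^n$. Let $k=k(n)\ge 1$ be integers with $k=O(\lg n)$, let $\ell=\ell(n)\ge 0$ be integers such that the alphabet $\Sigma_n=\bigcup_{i=0}^{\ell(n)}\{0,1\}^i$ satisfies $|\Sigma_n|=n^{O(1)}$, and let $\delta=\delta(n)$ be real numbers with $1/n^{O(1)}<\delta(n)$ for all sufficiently large $n$ and $\delta(n)<\frac12$ for all $n$. (Here $\lg=\log_2$.) Suppose that there are help strings $s(x_1,\dots,x_k)\in\Sigma_n$, one for each tuple $(x_1,\dots,x_k)\in(\{0,1\}^n)^k$, and an efficient (possibly non-uniform) algorithm, that is, Boolean circuits of size polynomial in $n$, one for each $n$ and each length $i\le\ell(n)$ of the help string, which for every $n$ and all $x_1,\dots,x_k\in\{0,1\}^n$, given $x_1,\dots,x_k$ and $s(x_1,\dots,x_k)$, outputs $(L(x_1),\dots,L(x_k))$. Let $X_1,\dots,X_k$ be independent and distributed according to $\mathcal D_n$, and let $M$ be the length of the random string $S=s(X_1,\dots,X_k)$.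 Assume that for every $n$, $M\le k$ almost surely and $$\mathbb E[M]\le k-3k\delta-\lg(k+1).$$ Then there are Boolean circuits $B_n$ of size polynomial in $n$, which take only an instance $x\in\{0,1\}^n$ as input (no help bits), such that for every $n$ $$\Pr_{x\sim\mathcal D_n}\big[B_n(x)=L(x)\big]\ \ge\ \tfrac12+\delta(n).$$ -/

import Mathlib

open Filter Asymptotics MeasureTheory
open scoped Topology

namespace HelpBits

/-- The answer bit of the language `L` on an instance `x` of size `n`:
`true` if `x ∈ L` and `false` otherwise. -/
noncomputable def answer (L : Language Bool) {n : ℕ} (x : Fin n → Bool) : Bool :=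
  open Classical in decide (List.ofFn x ∈ L)

/-- A gate of fan-in at most two. Each operand is an input bit (labelled by `ι`) or the value of one
of the `m` preceding gates. -/
inductive Gate (ι : Type) (m : ℕ) : Type
  | const (b : Bool) : Gate ι m
  | not (a : ι ⊕ Fin m) : Gate ι m
  | and (a b : ι ⊕ Fin m) : Gate ι m
  | or (a b : ι ⊕ Fin m) : Gate ι m

/-- The value of a gate when `w` gives the values of all wires available to it. -/
def Gate.eval {ι : Type} {m : ℕ} (w : ι ⊕ Fin m → Bool) : Gate ι m → Bool
  | .const b => b
  | .not a => !(w a)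
  | .and a b => w a && w b
  | .or a b => w a || w b

/-- A topologically ordered sequence of `m` gates over the inputs `ι`. -/
inductive Gates (ι : Type) : ℕ → Type
  | nil : Gates ι 0
  | snoc {m : ℕ} (G : Gates ι m) (g : Gate ι m) : Gates ι (m + 1)

/-- The values of all the gates on the input `x`. -/
def Gates.eval {ι : Type} (x : ι → Bool) : {m : ℕ} → Gates ι m → Fin m → Bool
  | _, .nil => Fin.elim0
  | _, .snoc G g =>
      Fin.snoc (α := fun _ => Bool) (G.eval x) (g.eval (Sum.elim x (G.eval x)))

/-- A Boolean circuit with input bits labelled by `ι` and output bits labelled by `κ`.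
Its size is the number of its gates. -/
structure Circuit (ι κ : Type) : Type where
  /-- the number of gates -/
  size : ℕ
  /-- the gates -/
  gates : Gates ι size
  /-- each output bit is read off an input or a gate -/
  output : κ → ι ⊕ Fin size

/-- The output of a circuit on the input `x`. -/
def Circuit.eval {ι κ : Type} (C : Circuit ι κ) (x : ι → Bool) : κ → Bool :=
  fun o => Sum.elim x (C.gates.eval x) (C.output o)

/-- The alphabet of the help bits: all bit strings of length at most `ℓ`, that is, the union of
`{0,1}^i` for `0 ≤ i ≤ ℓ`. -/
abbrev HelpString (ℓ : ℕ) : Type := Σ i : Fin (ℓ + 1), (Fin i → Bool)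

/-- The length of a string of help bits. -/
def HelpString.length {ℓ : ℕ} (s : HelpString ℓ) : ℕ := s.1

/-- A non-uniform algorithm that receives `k` instances of size `n` together with a string of at
most `ℓ` help bits and returns `k` bits. As usual there is one circuit for each input length, that
is, for each length `i ≤ ℓ` of the help. -/
abbrev HelpedCircuit (n k ℓ : ℕ) : Type :=
  (i : Fin (ℓ + 1)) → Circuit ((Fin k × Fin n) ⊕ Fin i) (Fin k)

/-- The output on the instances `x 0, …, x (k - 1)` and the help string `s`. -/
def HelpedCircuit.eval {n k ℓ : ℕ} (C : HelpedCircuit n k ℓ)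
    (x : Fin k → Fin n → Bool) (s : HelpString ℓ) : Fin k → Bool :=
  (C s.1).eval (Sum.elim (fun p => x p.1 p.2) s.2)

/-- The joint law of `k` independent instances, each drawn according to `D`. -/
noncomputable abbrev iid {n : ℕ} (D : Measure (Fin n → Bool)) (k : ℕ) :
    Measure (Fin k → Fin n → Bool) :=
  Measure.pi fun _ => D

end HelpBits

/-! Guess the help. A random string `b` of weight 2^(-|b|)/(k+1) hits `s x` with probability
2^(-M)/(k+1); by Jensen the average over the instances is at least 2^(-E[M])/(k+1), so some fixed
`b`, hardwired, answers all k instances correctly with probability at least 2^(-E[M])/(k+1) ≥ τ^k,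
where τ = 2^(3δ-1) (`exists_helpString`).

A direct product argument then extracts a predictor for one instance (`exists_predictor`). If fixing
some first instance leaves success at least τ^(k-1) on the others, fix it and recurse. Otherwise
every first instance `x` has tail success below τ^(k-1), so on average over `x` the head is right,
given a right tail, with probability about τ. The predictor tries hardwired tails with known answers
and outputs the head answer of the first trial whose tail is right (`exists_trials`).

Finally τ exceeds 1/2 + δ by a multiple of δ, which pays for the chance that all trials fail
(`half_add_le`). Since 2^k and 1/δ are polynomially bounded, polynomially many trials suffice. -/

namespace HelpBits

/-! ### Composition of circuits and size bounds -/

/-- Relabelling of the operands of a gate. -/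
def Gate.map {ι ι' : Type} {m m' : ℕ} (r : ι ⊕ Fin m → ι' ⊕ Fin m') : Gate ι m → Gate ι' m'
  | .const b => .const b
  | .not a => .not (r a)
  | .and a b => .and (r a) (r b)
  | .or a b => .or (r a) (r b)

theorem Gate.eval_map {ι ι' : Type} {m m' : ℕ} (r : ι ⊕ Fin m → ι' ⊕ Fin m')
    (w : ι' ⊕ Fin m' → Bool) (g : Gate ι m) : (g.map r).eval w = g.eval (fun a => w (r a)) := by
  cases g <;> rfl

/-- Gates may be placed on top of other gates, reading their inputs from any available wires. -/
theorem Gates.exists_append {ι ι' : Type} {m : ℕ} (G : Gates ι m) (σ : ι' → ι ⊕ Fin m)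
    {m' : ℕ} (H : Gates ι' m') :
    ∃ K : Gates ι (m + m'), ∀ x,
      (∀ i, K.eval x (Fin.castAdd m' i) = G.eval x i) ∧
      ∀ j, K.eval x (Fin.natAdd m j) = H.eval (fun a => Sum.elim x (G.eval x) (σ a)) j := by
  induction H with
  | nil => exact ⟨G, fun x => ⟨fun i => rfl, fun j => j.elim0⟩⟩
  | @snoc p H g ih =>
    obtain ⟨K, hK⟩ := ih
    refine ⟨.snoc K (g.map (Sum.elim (fun a => Sum.map id (Fin.castAdd p) (σ a))
      (fun j => .inr (Fin.natAdd m j)))), fun x => ⟨fun i => ?_, fun j => ?_⟩⟩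
    · rw [← (hK x).1 i]
      exact Fin.snoc_castSucc (α := fun _ => Bool) _ _ (Fin.castAdd p i)
    · refine Fin.lastCases ?_ (fun j => ?_) j
      · have h1 : Fin.natAdd m (Fin.last p) = Fin.last (m + p) := rfl
        rw [h1]
        simp only [Gates.eval, Fin.snoc_last, Gate.eval_map]
        refine (Fin.snoc_last (α := fun _ => Bool) _ _).trans (congrArg (g.eval ·) (funext fun a => ?_))
        rcases a with a | j
        · simp only [Sum.elim_inl]
          rcases σ a with b | i
          · rfl
          · exact (hK x).1 i
        · exact (hK x).2 j
      · have h1 : Fin.natAdd m j.castSucc = (Fin.natAdd m j).castSucc := rfl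
        rw [h1]
        simp only [Gates.eval, Fin.snoc_castSucc]
        exact (hK x).2 j

/-- The Boolean function `f` is computed by a circuit with at most `s` gates. -/
def SizeLE {ι : Type} (f : (ι → Bool) → Bool) (s : ℕ) : Prop :=
  ∃ B : Circuit ι Unit, B.size ≤ s ∧ ∀ x, B.eval x () = f x

namespace SizeLE

variable {ι : Type} {f g h : (ι → Bool) → Bool} {s t u : ℕ}

theorem mono (hf : SizeLE f s) (hst : s ≤ t) : SizeLE f t :=
  let ⟨B, hB, hx⟩ := hf
  ⟨B, hB.trans hst, hx⟩

theorem input (i : ι) : SizeLE (fun x => x i) 0 :=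
  ⟨⟨0, .nil, fun _ => .inl i⟩, le_rfl, fun _ => rfl⟩

theorem const (b : Bool) : SizeLE (fun _ : ι → Bool => b) 1 :=
  ⟨⟨1, .snoc .nil (.const b), fun _ => .inr (Fin.last 0)⟩, le_rfl, fun _ => by
    simp [Circuit.eval, Gates.eval, Gate.eval, Fin.snoc]⟩

theorem not (hf : SizeLE f s) : SizeLE (fun x => !(f x)) (s + 1) := by
  obtain ⟨B, hB, hx⟩ := hf
  refine ⟨⟨B.size + 1, .snoc B.gates (.not (B.output ())), fun _ => .inr (Fin.last _)⟩,
    Nat.succ_le_succ hB, fun x => ?_⟩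
  simp only [Circuit.eval, Gates.eval, Gate.eval, Sum.elim_inr, Fin.snoc_last]
  rw [← hx x]; rfl

/-- Two circuits on the same inputs can be evaluated side by side. -/
theorem exists_common (hf : SizeLE f s) (hg : SizeLE g t) :
    ∃ m ≤ s + t, ∃ (G : Gates ι m) (a b : ι ⊕ Fin m), ∀ x,
      Sum.elim x (G.eval x) a = f x ∧ Sum.elim x (G.eval x) b = g x := by
  obtain ⟨A, hA, hfx⟩ := hf
  obtain ⟨B, hB, hgx⟩ := hg
  obtain ⟨K, hK⟩ := A.gates.exists_append .inl B.gates
  refine ⟨_, add_le_add hA hB, K, Sum.map id (Fin.castAdd _) (A.output ()),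
    Sum.map id (Fin.natAdd _) (B.output ()), fun x => ⟨?_, ?_⟩⟩
  · rw [← hfx x, Circuit.eval]
    rcases A.output () with i | i
    · rfl
    · exact (hK x).1 i
  · rw [← hgx x, Circuit.eval]
    rcases B.output () with i | i
    · rfl
    · exact (hK x).2 i

theorem and (hf : SizeLE f s) (hg : SizeLE g t) : SizeLE (fun x => f x && g x) (s + t + 1) := by
  obtain ⟨m, hm, G, a, b, hx⟩ := hf.exists_common hg
  refine ⟨⟨m + 1, .snoc G (.and a b), fun _ => .inr (Fin.last _)⟩, Nat.succ_le_succ hm, fun x => ?_⟩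
  simp only [Circuit.eval, Gates.eval, Gate.eval, Sum.elim_inr, Fin.snoc_last, hx]

theorem or (hf : SizeLE f s) (hg : SizeLE g t) : SizeLE (fun x => f x || g x) (s + t + 1) := by
  obtain ⟨m, hm, G, a, b, hx⟩ := hf.exists_common hg
  refine ⟨⟨m + 1, .snoc G (.or a b), fun _ => .inr (Fin.last _)⟩, Nat.succ_le_succ hm, fun x => ?_⟩
  simp only [Circuit.eval, Gates.eval, Gate.eval, Sum.elim_inr, Fin.snoc_last, hx]

theorem beq_const (hf : SizeLE f s) (b : Bool) : SizeLE (fun x => f x == b) (s + 1) := by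
  cases b
  · simpa using hf.not
  · simpa using hf.mono (Nat.le_succ s)

theorem ite (hf : SizeLE f s) (hg : SizeLE g t) (hh : SizeLE h u) :
    SizeLE (fun x => if f x then g x else h x) (2 * s + t + u + 4) := by
  refine SizeLE.mono (s := (s + t + 1) + (s + 1 + u + 1) + 1) ?_ (by omega)
  convert (hf.and hg).or (hf.not.and hh) using 2 with x
  cases f x <;> simp

theorem forall_mem {α : Type} (S : Finset α) (F : α → (ι → Bool) → Bool)
    (hF : ∀ a, SizeLE (F a) s) (hf : ∀ x, f x = true ↔ ∀ a ∈ S, F a x = true) :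
    SizeLE f (S.card * (s + 1) + 1) := by
  classical
  induction S using Finset.induction_on generalizing f with
  | empty =>
    convert (const (ι := ι) true).mono le_add_self using 2 with x
    simpa using hf x
  | insert a S ha ih =>
    rw [Finset.card_insert_of_notMem ha]
    refine SizeLE.mono (s := s + (S.card * (s + 1) + 1) + 1) ?_ (by ring_nf; omega)
    convert (hF a).and (ih (f := fun x => decide (∀ a ∈ S, F a x = true)) fun x => by simp)
      using 2 with x
    rw [Bool.eq_iff_iff, hf]
    simp

/-- Some inputs of a circuit are replaced by inputs of another kind and the others by constants. -/
theorem of_substitution {κ κ' : Type} (C : Circuit κ κ') (r : κ → ι ⊕ Bool) (o : κ') :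
    SizeLE (fun x : ι → Bool => C.eval (fun a => Sum.elim x id (r a)) o) (2 + C.size) := by
  let G : Gates ι 2 := .snoc (.snoc .nil (.const false)) (.const true)
  have hG : ∀ x, G.eval x 0 = false ∧ G.eval x 1 = true := fun x => ⟨rfl, rfl⟩
  let e : ι ⊕ Bool → ι ⊕ Fin 2 := Sum.map id (fun b => if b then 1 else 0)
  have he : ∀ x a, Sum.elim x (G.eval x) (e a) = Sum.elim x id a := by
    rintro x (a | b)
    · rfl
    · cases b
      · exact (hG x).1
      · exact (hG x).2
  obtain ⟨K, hK⟩ := G.exists_append (fun a => e (r a)) C.gates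
  simp only [he] at hK
  refine ⟨⟨2 + C.size, K, fun _ => Sum.elim (fun a => Sum.map id (Fin.castAdd _) (e (r a)))
    (fun j => .inr (Fin.natAdd _ j)) (C.output o)⟩, le_rfl, fun x => ?_⟩
  simp only [Circuit.eval]
  rcases C.output o with a | j
  · simp only [Sum.elim_inl]
    rw [← he x (r a)]
    rcases e (r a) with b | i
    · rfl
    · exact (hK x).1 i
  · exact (hK x).2 j

end SizeLE

/-- Every Boolean function of finitely many bits is computed by some circuit. -/
theorem exists_sizeLE {ι : Type} [Fintype ι] (f : (ι → Bool) → Bool) : ∃ s, SizeLE f s := by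
  classical
  refine ⟨_, SizeLE.forall_mem (Finset.univ.filter fun a => f a = false)
    (fun a x => !decide (x = a)) (fun a => SizeLE.not (SizeLE.forall_mem Finset.univ
      (fun i x => x i == a i) (fun i => (SizeLE.input i).beq_const (a i)) fun x => ?_))
    fun x => ?_⟩
  · simp [funext_iff]
  · simp only [Finset.mem_filter, Finset.mem_univ, true_and, Bool.not_eq_true',
      decide_eq_false_iff_not]
    refine ⟨fun hx a ha h => ?_, fun h => ?_⟩
    · rw [h, ha] at hx
      exact Bool.false_ne_true hx
    · by_contra hx
      exact h x (by simpa using hx) rfl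

/-- The answer of the first trial in `l` that succeeds on `x`. -/
def firstSuccess {X Y : Type} (ok out : X → Y → Bool) : List Y → X → Bool
  | [], _ => false
  | y :: l, x => if ok x y then out x y else firstSuccess ok out l x

/-- The size is linear in the number of trials because `ite` duplicates only its condition, never
the remaining list. -/
theorem SizeLE.firstSuccess {ι Y : Type} {ok out : (ι → Bool) → Y → Bool} {s t : ℕ}
    (hok : ∀ y, SizeLE (fun x => ok x y) s) (hout : ∀ y, SizeLE (fun x => out x y) t)
    (l : List Y) :
    SizeLE (firstSuccess ok out l) (l.length * (2 * s + t + 4) + 1) := by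
  induction l with
  | nil =>
    simp only [List.length_nil, zero_mul]
    exact SizeLE.const false
  | cons y l ih =>
    refine SizeLE.mono ((hok y).ite (hout y) ih) (le_of_eq ?_)
    simp only [List.length_cons]
    ring

/-! ### Derandomized repeated trials -/

/-- A weighted average, of total weight at most one, is at most one of the averaged values. -/
theorem exists_le_of_le_sum {Y : Type} [Fintype Y] [Nonempty Y] (ν F : Y → ℝ)
    (hν : ∀ y, 0 ≤ ν y) (hν1 : ∑ y, ν y ≤ 1) (hF : ∀ y, 0 ≤ F y) {c : ℝ}
    (h : c ≤ ∑ y, ν y * F y) : ∃ y, c ≤ F y := by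
  obtain ⟨y₀, hy₀⟩ := Finite.exists_max F
  refine ⟨y₀, h.trans ?_⟩
  calc ∑ y, ν y * F y ≤ (∑ y, ν y) * F y₀ := by
        rw [Finset.sum_mul]
        exact Finset.sum_le_sum fun y _ => mul_le_mul_of_nonneg_left (hy₀ y) (hν y)
    _ ≤ F y₀ := mul_le_of_le_one_left (hF y₀) hν1

/-- Repeating independent trials: if on every `x` a trial succeeds with probability at most `P`,
then some `T` fixed trials are, in total, correct on at least the weight `∑ w q` multiplied by the
geometric sum, where `q x` is the probability that a trial succeeds with the right answer. -/
theorem exists_trials {X Y : Type} [Fintype X] [Fintype Y] [Nonempty Y] (ν : Y → ℝ)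
    (hν : ∀ y, 0 ≤ ν y) (hν1 : ∑ y, ν y = 1) (ok out : X → Y → Bool) (f : X → Bool) {P : ℝ} (hP1 : P ≤ 1)
    (hP : ∀ x, ∑ y, ν y * (if ok x y then 1 else 0) ≤ P) (T : ℕ) (w : X → ℝ) (hw : ∀ x, 0 ≤ w x) :
    ∃ l : List Y, l.length = T ∧
      (∑ x, w x * ∑ y, ν y * (if ok x y ∧ out x y = f x then 1 else 0)) *
        ∑ t ∈ Finset.range T, (1 - P) ^ t ≤
      ∑ x, w x * (if firstSuccess ok out l x = f x then 1 else 0) := by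
  set q : X → ℝ := fun x => ∑ y, ν y * (if ok x y ∧ out x y = f x then 1 else 0) with hq
  have hq0 : ∀ x, 0 ≤ q x := fun x => Finset.sum_nonneg fun y _ =>
    mul_nonneg (hν y) (by split_ifs <;> norm_num)
  induction T generalizing w with
  | zero =>
    refine ⟨[], rfl, ?_⟩
    simp only [Finset.range_zero, Finset.sum_empty, mul_zero]
    exact Finset.sum_nonneg fun x _ => mul_nonneg (hw x) (by split_ifs <;> norm_num)
  | succ T ih =>
    set S := ∑ t ∈ Finset.range T, (1 - P) ^ t with hS
    have hS0 : 0 ≤ S := Finset.sum_nonneg fun t _ => pow_nonneg (by linarith) t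
    -- The average over the first trial `y`: a success is credited if its answer is right, a failure
    -- passes `x` on to the remaining `T` trials.
    have hav : (∑ x, w x * q x) * ∑ t ∈ Finset.range (T + 1), (1 - P) ^ t ≤
        ∑ y, ν y * ∑ x, w x * ((if ok x y ∧ out x y = f x then 1 else 0) +
          (if ok x y then 0 else 1) * (q x * S)) := by
      have h1 : ∑ t ∈ Finset.range (T + 1), (1 - P) ^ t = 1 + (1 - P) * S := by
        rw [Finset.sum_range_succ', Finset.mul_sum, pow_zero, add_comm]
        simp only [pow_succ']
      rw [h1, Finset.sum_mul]
      simp only [Finset.mul_sum]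
      rw [Finset.sum_comm]
      refine Finset.sum_le_sum fun x _ => ?_
      have h2 : ∑ y, ν y * (w x * ((if ok x y ∧ out x y = f x then 1 else 0) +
          (if ok x y then 0 else 1) * (q x * S))) =
          w x * (q x + (1 - ∑ y, ν y * (if ok x y then 1 else 0)) * (q x * S)) := by
        have h3 : 1 - ∑ y, ν y * (if ok x y then 1 else 0) =
            ∑ y, ν y * (if ok x y then 0 else 1) := by
          rw [sub_eq_iff_eq_add, ← Finset.sum_add_distrib]
          exact hν1.symm.trans (Finset.sum_congr rfl fun y _ => by split_ifs <;> ring)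
        rw [h3]
        generalize q x * S = c
        rw [Finset.sum_mul, hq, ← Finset.sum_add_distrib, Finset.mul_sum]
        exact Finset.sum_congr rfl fun y _ => by ring
      rw [h2, mul_assoc]
      refine mul_le_mul_of_nonneg_left ?_ (hw x)
      -- An upper bound on the success probability is what helps here: each trial leaves at least
      -- the fraction `1 - P` of the chances to later trials.
      nlinarith [mul_le_mul_of_nonneg_right (hP x) (mul_nonneg (hq0 x) hS0)]
    obtain ⟨y, hy⟩ := exists_le_of_le_sum ν _ hν hν1.le
      (fun y => Finset.sum_nonneg fun x _ => mul_nonneg (hw x) (add_nonneg (by split_ifs <;> norm_num)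
        (mul_nonneg (by split_ifs <;> norm_num) (mul_nonneg (hq0 x) hS0)))) hav
    -- The new weight keeps only the inputs on which the chosen `y` fails.
    obtain ⟨l, hl, hle⟩ := ih (fun x => w x * (if ok x y then 0 else 1)) fun x =>
      mul_nonneg (hw x) (by split_ifs <;> norm_num)
    refine ⟨y :: l, by simp [hl], hy.trans ?_⟩
    simp only [mul_add, Finset.sum_add_distrib]
    calc _ = ∑ x, w x * (if ok x y ∧ out x y = f x then 1 else 0) +
          (∑ x, w x * (if ok x y then 0 else 1) * q x) * S := by
            rw [Finset.sum_mul]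
            simp only [mul_assoc]
      _ ≤ _ := add_le_add_right hle _
      _ = _ := by
        rw [← Finset.sum_add_distrib]
        refine Finset.sum_congr rfl fun x _ => ?_
        by_cases h : ok x y <;> simp [firstSuccess, h]

/-! ### Direct product theorem -/

/-- The probability that `A` is right on all of `k` independent instances. -/
noncomputable def successProb {X : Type} [Fintype X] (μ : X → ℝ) (f : X → Bool) {k : ℕ}
    (A : (Fin k → X) → Fin k → Bool) : ℝ :=
  ∑ x, (∏ j, μ (x j)) * (if ∀ j, A x j = f (x j) then 1 else 0)

theorem sum_prod_eq_one {X : Type} [Fintype X] (μ : X → ℝ) (hμ1 : ∑ x, μ x = 1) (k : ℕ) :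
    ∑ x : Fin k → X, ∏ j, μ (x j) = 1 := by
  classical
  rw [← Fintype.piFinset_univ, Finset.sum_prod_piFinset]
  simp [hμ1]

theorem successProb_succ {X : Type} [Fintype X] (μ : X → ℝ) (f : X → Bool) {k : ℕ}
    (A : (Fin (k + 1) → X) → Fin (k + 1) → Bool) :
    successProb μ f A = ∑ x, μ x * ∑ y : Fin k → X, (∏ j, μ (y j)) *
      (if (∀ j : Fin k, A (Fin.cons x y) j.succ = f (y j)) ∧ A (Fin.cons x y) 0 = f x
        then 1 else 0) := by
  rw [successProb, ← (Fin.consEquiv fun _ => X).sum_comp, Fintype.sum_prod_type]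
  refine Finset.sum_congr rfl fun x _ => ?_
  rw [Finset.mul_sum]
  refine Finset.sum_congr rfl fun y _ => ?_
  change (∏ j, μ ((Fin.cons x y : Fin (k + 1) → X) j)) * (if ∀ j, A (Fin.cons x y) j =
    f ((Fin.cons x y : Fin (k + 1) → X) j) then 1 else 0) = _
  simp only [ Fin.prod_univ_succ, Fin.cons_zero, Fin.cons_succ,
    Fin.forall_fin_succ, mul_assoc, and_comm]

/-- The predictor that embeds an instance `x` in `k + 1` instances, the others being known, and
trusts the answer on `x` as soon as the other answers are right. -/
theorem exists_predictor_of_tail_le {ι : Type} [Fintype ι] [DecidableEq ι] (μ : (ι → Bool) → ℝ)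
    (hμ : ∀ x, 0 ≤ μ x) (hμ1 : ∑ x, μ x = 1) (f : (ι → Bool) → Bool) {τ : ℝ} (hτ0 : 0 ≤ τ)
    (hτ1 : τ ≤ 1) (T s k : ℕ) (A : (Fin (k + 1) → ι → Bool) → Fin (k + 1) → Bool)
    (hA : ∀ z i j, SizeLE (fun x => A (Function.update z i x) j) s)
    (hτ : τ ^ (k + 1) ≤ successProb μ f A)
    (htail : ∀ x, successProb μ f (fun y j => A (Fin.cons x y) (Fin.succ j)) ≤ τ ^ k) :
    ∃ B, SizeLE B (T * (2 * (k * (s + 2) + 1) + s + 4) + 1) ∧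
      τ * (1 - (1 - τ ^ k) ^ T) ≤ ∑ x, μ x * (if B x = f x then 1 else 0) := by
  classical
  have hA' : ∀ (y : Fin k → ι → Bool) j, SizeLE (fun x => A (Fin.cons x y) j) s := fun y j => by
    simpa only [Fin.update_cons_zero] using hA (Fin.cons (fun _ => false) y) 0 j
  obtain ⟨l, hl, hle⟩ := exists_trials (fun y : Fin k → ι → Bool => ∏ j, μ (y j))
    (fun y => Finset.prod_nonneg fun j _ => hμ _) (sum_prod_eq_one μ hμ1 k)
    (fun x y => decide (∀ j ∈ Finset.univ, (A (Fin.cons x y) (Fin.succ j) == f (y j)) = true))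
    (fun x y => A (Fin.cons x y) 0) f (pow_le_one₀ hτ0 hτ1 : τ ^ k ≤ 1)
    (fun x => by simpa [successProb] using htail x) T μ hμ
  refine ⟨_, ?_, le_trans ?_ hle⟩
  · refine (SizeLE.firstSuccess (s := k * (s + 2) + 1) (fun y => ?_) (fun y => hA' y 0) l).mono
      (by rw [hl])
    simpa using SizeLE.forall_mem (Finset.univ : Finset (Fin k)) _
      (fun j => (hA' y j.succ).beq_const (f (y j))) fun x => decide_eq_true_iff
  · rw [successProb_succ] at hτ
    simp only [Finset.mem_univ, true_imp_iff, beq_iff_eq, decide_eq_true_eq]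
    -- Multiplying τ^(k+1) by the geometric sum (1 - (1 - τ^k)^T) / τ^k leaves one factor τ.
    have hS : (∑ t ∈ Finset.range T, (1 - τ ^ k) ^ t) * τ ^ k = 1 - (1 - τ ^ k) ^ T := by
      have := geom_sum_mul_neg (1 - τ ^ k) T
      rwa [sub_sub_cancel] at this
    rw [← hS]
    refine le_trans (le_of_eq ?_) (mul_le_mul_of_nonneg_right hτ (Finset.sum_nonneg fun t _ =>
      pow_nonneg (sub_nonneg.2 (pow_le_one₀ hτ0 hτ1)) t))
    ring

/-- A direct product theorem: an algorithm that is right on all of `k + 1` independent instances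
with probability at least `τ ^ (k + 1)` yields a predictor for a single instance. -/
theorem exists_predictor {ι : Type} [Fintype ι] [DecidableEq ι] (μ : (ι → Bool) → ℝ) (hμ : ∀ x, 0 ≤ μ x)
    (hμ1 : ∑ x, μ x = 1) (f : (ι → Bool) → Bool) {τ : ℝ} (hτ0 : 0 ≤ τ) (hτ1 : τ ≤ 1) (T s : ℕ)
    (k : ℕ) (A : (Fin (k + 1) → ι → Bool) → Fin (k + 1) → Bool)
    (hA : ∀ z i j, SizeLE (fun x => A (Function.update z i x) j) s)
    (hτ : τ ^ (k + 1) ≤ successProb μ f A) :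
    ∃ B, SizeLE B (T * (2 * (k * (s + 2) + 1) + s + 4) + 1) ∧
      τ * (1 - (1 - τ ^ k) ^ T) ≤ ∑ x, μ x * (if B x = f x then 1 else 0) := by
  induction k with
  | zero =>
    refine exists_predictor_of_tail_le μ hμ hμ1 f hτ0 hτ1 T s 0 A hA hτ fun x => ?_
    simp [successProb]
  | succ k ih =>
    by_cases h : ∃ x, τ ^ (k + 1) ≤ successProb μ f (fun y j => A (Fin.cons x y) (Fin.succ j))
    · obtain ⟨x, hx⟩ := h
      obtain ⟨B, hB, hle⟩ := ih (fun y j => A (Fin.cons x y) (Fin.succ j))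
        (fun z i j => by simpa only [Fin.cons_update] using hA (Fin.cons x z) i.succ j.succ) hx
      refine ⟨B, hB.mono (by gcongr; omega), le_trans ?_ hle⟩
      -- The guarantee for fewer instances is stronger: a larger success threshold makes the failure
      -- term smaller.
      have h1 := pow_le_pow_of_le_one hτ0 hτ1 (Nat.le_succ k)
      have h2 := sub_nonneg.2 (pow_le_one₀ hτ0 hτ1 (n := k))
      gcongr
    · push Not at h
      exact exists_predictor_of_tail_le μ hμ hμ1 f hτ0 hτ1 T s (k + 1) A hA hτ fun x => (h x).le

/-! ### Fixing the help string -/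

/-- Kraft's inequality, for the strings of length at most `k`, each length having weight
`1 / (k + 1)`. -/
theorem kraft (ℓ k : ℕ) :
    ∑ b : HelpString ℓ, (if b.length ≤ k then ((2 : ℝ) ^ b.length * (k + 1))⁻¹ else 0) ≤ 1 := by
  rw [Fintype.sum_sigma]
  have h1 : ∀ i : Fin (ℓ + 1), ∑ b : Fin i → Bool,
      (if HelpString.length (⟨i, b⟩ : HelpString ℓ) ≤ k then
        ((2 : ℝ) ^ HelpString.length (⟨i, b⟩ : HelpString ℓ) * (k + 1))⁻¹ else 0) =
      if (i : ℕ) ≤ k then ((k : ℝ) + 1)⁻¹ else 0 := by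
    intro i
    change ∑ b : Fin i → Bool, (if (i : ℕ) ≤ k then ((2 : ℝ) ^ (i : ℕ) * (k + 1))⁻¹ else 0) = _
    simp only [Finset.sum_const, Finset.card_univ, Fintype.card_fun,
      Fintype.card_bool, Fintype.card_fin, nsmul_eq_mul, Nat.cast_pow, Nat.cast_ofNat]
    split_ifs
    · rw [mul_inv, ← mul_assoc, mul_inv_cancel₀ (by positivity), one_mul]
    · simp
  simp only [h1]
  rw [Fin.sum_univ_eq_sum_range (fun i => if i ≤ k then ((k : ℝ) + 1)⁻¹ else 0),
    ← Finset.sum_filter, Finset.sum_const, nsmul_eq_mul]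
  have h2 : ((Finset.range (ℓ + 1)).filter (· ≤ k)).card ≤ k + 1 := by
    rw [← Finset.card_range (k + 1)]
    exact Finset.card_le_card fun i hi => by
      simp only [Finset.mem_filter, Finset.mem_range] at hi ⊢
      omega
  rw [← div_eq_mul_inv, div_le_one (by positivity)]
  exact_mod_cast h2

/-- Some fixed help string is right with probability at least `2 ^ (-E[M]) / (k + 1)`. -/
theorem exists_helpString {Ω : Type} [Fintype Ω] (ν : Ω → ℝ) (hν : ∀ x, 0 ≤ ν x)
    (hν1 : ∑ x, ν x = 1) {ℓ k : ℕ} (s : Ω → HelpString ℓ) (good : Ω → HelpString ℓ → Prop)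
    [∀ x b, Decidable (good x b)] (hgood : ∀ x, good x (s x))
    (hs : ∀ x, ν x ≠ 0 → (s x).length ≤ k) :
    ∃ b, (2 : ℝ) ^ (-∑ x, ν x * (s x).length) / (k + 1) ≤
      ∑ x, ν x * (if good x b then 1 else 0) := by
  classical
  set W : HelpString ℓ → ℝ := fun b =>
    if b.length ≤ k then ((2 : ℝ) ^ b.length * (k + 1))⁻¹ else 0 with hW
  have hW0 : ∀ b, 0 ≤ W b := fun b => by
    simp only [hW]
    split_ifs <;> positivity
  have : Nonempty (HelpString ℓ) := ⟨⟨0, Fin.elim0⟩⟩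
  refine exists_le_of_le_sum W _ hW0 (kraft ℓ k) (fun b => Finset.sum_nonneg fun x _ =>
    mul_nonneg (hν x) (by split_ifs <;> norm_num)) ?_
  -- Jensen's inequality for the exponential.
  have hJ : (2 : ℝ) ^ (-∑ x, ν x * (s x).length) ≤ ∑ x, ν x * ((2 : ℝ) ^ (s x).length)⁻¹ := by
    have := convexOn_exp.map_sum_le (t := Finset.univ) (w := ν)
      (p := fun x => Real.log 2 * -((s x).length : ℝ)) (fun x _ => hν x) hν1 (fun x _ => trivial)
    simp only [smul_eq_mul] at this
    rw [Real.rpow_def_of_pos two_pos]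
    refine le_trans (le_of_eq ?_) (this.trans (le_of_eq ?_))
    · rw [← Finset.sum_neg_distrib, Finset.mul_sum]
      congr 1
      exact Finset.sum_congr rfl fun x _ => by ring
    · refine Finset.sum_congr rfl fun x _ => ?_
      rw [← Real.rpow_def_of_pos two_pos, Real.rpow_neg two_pos.le, Real.rpow_natCast]
  calc _ ≤ (∑ x, ν x * ((2 : ℝ) ^ (s x).length)⁻¹) / (k + 1) := by gcongr
    _ ≤ ∑ x, ∑ b, W b * (ν x * (if good x b then 1 else 0)) := by
      rw [Finset.sum_div]
      refine Finset.sum_le_sum fun x _ => ?_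
      refine le_trans ?_ (Finset.single_le_sum (f := fun b => W b * (ν x * if good x b then 1 else 0))
        (fun b _ => mul_nonneg (hW0 b) (mul_nonneg (hν x) (by split_ifs <;> norm_num)))
        (Finset.mem_univ (s x)))
      simp only [hgood x, if_true, mul_one, hW]
      -- The length bound holds only almost surely; tuples of probability zero contribute nothing.
      rcases eq_or_ne (ν x) 0 with h0 | h0
      · simp [h0]
      · rw [if_pos (hs x h0), mul_inv, div_eq_mul_inv]
        exact le_of_eq (by ring)
    _ = _ := by
      rw [Finset.sum_comm]
      simp only [Finset.mul_sum]

/-! ### Estimates and assembly -/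

/-- With enough trials the loss of the predictor is negligible. -/
theorem half_add_le {δ : ℝ} (hδ0 : 0 < δ) {k T : ℕ} (hT : 100 * 2 ^ k ≤ δ * T)
    (hτ : (2 : ℝ) ^ (3 * δ - 1) ≤ 1) :
    1 / 2 + δ ≤ (2 : ℝ) ^ (3 * δ - 1) * (1 - (1 - ((2 : ℝ) ^ (3 * δ - 1)) ^ k) ^ T) := by
  set τ := (2 : ℝ) ^ (3 * δ - 1) with hτd
  -- From exp t ≥ 1 + t, as (3/2) log 2 > 1.03; the surplus 0.03 δ absorbs the loss of at most δ/100
  -- in `h7`.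
  have h1 : 1 / 2 + 1.03 * δ ≤ τ := by
    have h2 : τ = Real.exp (Real.log 2 * (3 * δ)) / 2 := by
      rw [hτd, Real.rpow_sub two_pos, Real.rpow_one, Real.rpow_def_of_pos two_pos]
    rw [h2]
    nlinarith [Real.add_one_le_exp (Real.log 2 * (3 * δ)), Real.log_two_gt_d9]
  set p : ℝ := (1 / 2) ^ k with hp
  have hp0 : 0 < p := by positivity
  have hp1 : p ≤ 1 := pow_le_one₀ (by norm_num) (by norm_num)
  have hpτ : p ≤ τ ^ k := pow_le_pow_left₀ (by norm_num) (by linarith) k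
  have hτ0 : 0 ≤ τ := by positivity
  have hτk : τ ^ k ≤ 1 := pow_le_one₀ hτ0 hτ
  have h3 : (1 - τ ^ k) ^ T ≤ (1 - p) ^ T := pow_le_pow_left₀ (by linarith) (by linarith) T
  -- Bernoulli gives 1 + Tp ≤ (1 + p)^T, and (1 - p²)^T ≤ 1.
  have h4 : (1 - p) ^ T * (1 + T * p) ≤ 1 := by
    calc (1 - p) ^ T * (1 + T * p) ≤ (1 - p) ^ T * (1 + p) ^ T := by
          refine mul_le_mul_of_nonneg_left ?_ (pow_nonneg (by linarith) T)
          exact one_add_mul_le_pow (by linarith) T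
      _ = ((1 - p) * (1 + p)) ^ T := (mul_pow _ _ T).symm
      _ ≤ 1 := pow_le_one₀ (mul_nonneg (by linarith) (by linarith)) (by nlinarith)
  have h5 : 100 ≤ δ * (T * p) := by
    have h6 : (2 : ℝ) ^ k * p = 1 := by rw [hp, ← mul_pow]; norm_num
    calc (100 : ℝ) = 100 * 2 ^ k * p := by rw [mul_assoc, h6, mul_one]
      _ ≤ δ * T * p := mul_le_mul_of_nonneg_right hT hp0.le
      _ = _ := mul_assoc _ _ _
  have h7 : (1 - p) ^ T ≤ δ / 100 := by
    have h8 : 0 ≤ (1 - p) ^ T := pow_nonneg (by linarith) T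
    have h9 : 100 * (1 - p) ^ T ≤ δ * (T * p) * (1 - p) ^ T := mul_le_mul_of_nonneg_right h5 h8
    have h10 : δ * ((1 - p) ^ T * (1 + T * p)) ≤ δ * 1 := mul_le_mul_of_nonneg_left h4 hδ0.le
    nlinarith
  have h11 : 0 ≤ (1 - τ ^ k) ^ T := pow_nonneg (by linarith) T
  nlinarith

theorem iid_real_singleton {n : ℕ} (D : Measure (Fin n → Bool)) [IsProbabilityMeasure D] (k : ℕ)
    (x : Fin k → Fin n → Bool) : (iid D k).real {x} = ∏ j, D.real {x j} := by
  simp [iid, measureReal_def, ENNReal.toReal_prod]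

/-- The conclusion for one input length, with an arbitrary number `T` of trials. -/
theorem exists_predictor_of_help (L : Language Bool) {n k ℓ : ℕ} (D : Measure (Fin n → Bool))
    [IsProbabilityMeasure D] (δ : ℝ) (s : (Fin (k + 1) → Fin n → Bool) → HelpString ℓ)
    (C : HelpedCircuit n (k + 1) ℓ) (hC : ∀ x, C.eval x (s x) = fun j => answer L (x j))
    {S : ℕ} (hS : ∀ i, (C i).size ≤ S)
    (hM : ∀ᵐ x ∂(iid D (k + 1)), (s x).length ≤ k + 1)
    (hEM : ∫ x, ((s x).length : ℝ) ∂(iid D (k + 1)) ≤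
      ((k + 1 : ℕ) : ℝ) - 3 * (k + 1 : ℕ) * δ - Real.logb 2 (((k + 1 : ℕ) : ℝ) + 1)) (T : ℕ) :
    (2 : ℝ) ^ (3 * δ - 1) ≤ 1 ∧
    ∃ B, SizeLE B (T * (2 * (k * (S + 2 + 2) + 1) + (S + 2) + 4) + 1) ∧
      (2 : ℝ) ^ (3 * δ - 1) * (1 - (1 - ((2 : ℝ) ^ (3 * δ - 1)) ^ k) ^ T) ≤
        D.real {x | B x = answer L x} := by
  classical
  have hsum : ∀ (E : (Fin n → Bool) → Prop) [DecidablePred E],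
      ∑ x, D.real {x} * (if E x then 1 else 0) = D.real {x | E x} := by
    intro E _
    have h := sum_measureReal_singleton (μ := D) (Finset.univ.filter E)
    simp only [mul_ite, mul_one, mul_zero, ← Finset.sum_filter]
    rw [h]
    simp
  set ν : (Fin (k + 1) → Fin n → Bool) → ℝ := fun x => ∏ j, D.real {x j} with hν
  have hμ1 : ∑ x, D.real {x} = 1 := by
    simp
  have hint : ∫ x, ((s x).length : ℝ) ∂(iid D (k + 1)) = ∑ x, ν x * (s x).length := by
    rw [integral_fintype (Integrable.of_finite)]
    exact Finset.sum_congr rfl fun x _ => by rw [iid_real_singleton, smul_eq_mul]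
  obtain ⟨b, hb⟩ := exists_helpString (k := k + 1) ν
    (fun x => Finset.prod_nonneg fun j _ => measureReal_nonneg) (sum_prod_eq_one _ hμ1 _) s
    (fun x b => ∀ j, C.eval x b j = answer L (x j)) (fun x j => congrFun (hC x) j) fun x hx => by
      refine (ae_iff_of_countable.1 hM) x fun h => hx ?_
      change ∏ j, D.real {x j} = 0
      rw [← iid_real_singleton, measureReal_def, h, ENNReal.toReal_zero]
  set τ := (2 : ℝ) ^ (3 * δ - 1) with hτ
  have hτ0 : 0 < τ := by positivity
  have hpow : τ ^ (k + 1) ≤ successProb (fun x => D.real {x}) (answer L) (fun x => C.eval x b) := by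
    refine le_trans ?_ hb
    have hk0 : (0 : ℝ) < ((k + 1 : ℕ) : ℝ) + 1 := by positivity
    rw [hτ, ← Real.rpow_natCast, ← Real.rpow_mul two_pos.le, le_div_iff₀ hk0]
    rw [← Real.rpow_logb two_pos (by norm_num) hk0, ← Real.rpow_add two_pos]
    refine Real.rpow_le_rpow_of_exponent_le one_le_two ?_
    rw [hint] at hEM
    linarith
  -- No bound on δ is needed: τ > 1 would make a success probability exceed 1.
  have hτ1 : τ ≤ 1 := by
    by_contra! h
    have h1 : successProb (fun x => D.real {x}) (answer L) (fun x => C.eval x b) ≤ 1 := by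
      rw [← sum_prod_eq_one _ hμ1 (k + 1)]
      exact Finset.sum_le_sum fun x _ => mul_le_of_le_one_right
        (Finset.prod_nonneg fun j _ => measureReal_nonneg) (by split_ifs <;> norm_num)
    exact absurd (hpow.trans h1) (not_le.2 (one_lt_pow₀ h k.succ_ne_zero))
  refine ⟨hτ1, ?_⟩
  obtain ⟨B, hB, hle⟩ := exists_predictor (fun x => D.real {x}) (fun x => measureReal_nonneg) hμ1
    (answer L) hτ0.le hτ1 T (S + 2) k (fun x => C.eval x b) (fun z i j => by
      -- The two extra gates supply the constants for the hardwired instances and help bits.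
      refine SizeLE.mono (s := 2 + (C b.1).size) ?_ (by have := hS b.1; omega)
      convert SizeLE.of_substitution (C b.1) (Sum.elim
        (fun p => if p.1 = i then .inl p.2 else .inr (z p.1 p.2)) fun a => .inr (b.2 a)) j
        using 2 with x
      refine congrFun (congrArg (C b.1).eval (funext fun a => ?_)) j
      rcases a with p | a
      · by_cases h : p.1 = i
        · simp [h]
        · simp [h]
      · rfl) hpow
  exact ⟨B, hB, hle.trans_eq (hsum _)⟩

end HelpBits

theorem mainTheorem6
    (L : Language Bool)
    (D : (n : ℕ) → Measure (Fin n → Bool)) [∀ n, IsProbabilityMeasure (D n)]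
    (k ℓ : ℕ → ℕ) (δ : ℕ → ℝ)
    (hk_pos : ∀ n, 1 ≤ k n)
    -- `k = O(lg n)`
    (hk : (fun n => (k n : ℝ)) =O[atTop] (fun n => Real.logb 2 (n : ℝ)))
    -- the help alphabet has polynomial size
    (hℓ : ∃ c : ℕ, ∀ᶠ n in atTop, Fintype.card (HelpBits.HelpString (ℓ n)) ≤ n ^ c)
    -- the help bits are a function of the `k` instances
    (s : (n : ℕ) → (Fin (k n) → Fin n → Bool) → HelpBits.HelpString (ℓ n))
    -- polynomial-size circuits that solve every `k` instances given their help bits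
    (C : (n : ℕ) → HelpBits.HelpedCircuit n (k n) (ℓ n))
    (hC_size : ∃ p : Polynomial ℕ, ∀ n i, (C n i).size ≤ p.eval n)
    (hC : ∀ n x, (C n).eval x (s n x) = fun j => HelpBits.answer L (x j))
    -- `1 / n ^ O(1) < δ < 1 / 2`
    (hδ : ∃ c : ℕ, ∀ᶠ n : ℕ in atTop, 1 / (n : ℝ) ^ c < δ n)
    (hδ' : ∀ n, δ n < 1 / 2)
    -- `M ≤ k` and `E[M] ≤ k - 3 k δ - lg (k + 1)`, with `M` the length of the help bits
    (hM : ∀ n, ∀ᵐ x ∂(HelpBits.iid (D n) (k n)), (s n x).length ≤ k n)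
    (hEM : ∀ n, ∫ x, ((s n x).length : ℝ) ∂(HelpBits.iid (D n) (k n)) ≤
      (k n : ℝ) - 3 * k n * δ n - Real.logb 2 ((k n : ℝ) + 1)) :
    ∃ B : (n : ℕ) → HelpBits.Circuit (Fin n) Unit,
      (∃ p : Polynomial ℕ, ∀ n, (B n).size ≤ p.eval n) ∧
      ∀ n, 1 / 2 + δ n ≤ (D n).real {x | (B n).eval x () = HelpBits.answer L x} := by
  obtain ⟨p, hp⟩ := hC_size
  obtain ⟨c, hc⟩ := hδ
  obtain ⟨r, hr⟩ := hk.bound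
  obtain ⟨d, hd⟩ := exists_nat_ge r
  have hk2 : ∀ᶠ n : ℕ in atTop, 2 ^ k n ≤ n ^ d := by
    filter_upwards [hr, eventually_ge_atTop 1] with n hn hn1
    have hn1' : (1 : ℝ) ≤ n := by exact_mod_cast hn1
    have hlog : 0 ≤ Real.logb 2 n := Real.logb_nonneg one_lt_two hn1'
    rw [Real.norm_natCast, Real.norm_of_nonneg hlog] at hn
    have h1 : (k n : ℝ) ≤ Real.logb 2 n * d :=
      hn.trans (by rw [mul_comm]; exact mul_le_mul_of_nonneg_left hd hlog)
    have h2 : (2 : ℝ) ^ k n ≤ (n : ℝ) ^ d := by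
      rw [← Real.rpow_natCast, ← Real.rpow_natCast]
      rw [← Real.rpow_logb two_pos (by norm_num) (by linarith : (0 : ℝ) < n),
        ← Real.rpow_mul two_pos.le]
      exact Real.rpow_le_rpow_of_exponent_le one_le_two h1
    exact_mod_cast h2
  obtain ⟨N, hN⟩ := eventually_atTop.1 ((hc.and hk2).and (eventually_ge_atTop 1))
  -- The number of trials is 100 n^(d+c), since 2^k ≤ n^d and 1/δ < n^c; the factor X^d also bounds
  -- k itself.
  let q : Polynomial ℕ := 100 * Polynomial.X ^ (d + c) *
    (2 * (Polynomial.X ^ d * (p + 4) + 1) + p + 6) + 1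
  have hlarge : ∀ n, N ≤ n → ∃ B : HelpBits.Circuit (Fin n) Unit, B.size ≤ q.eval n ∧
      1 / 2 + δ n ≤ (D n).real {x | B.eval x () = HelpBits.answer L x} := by
    intro n hn
    obtain ⟨⟨hδn, hkn⟩, hn1⟩ := hN n hn
    have hn1' : (1 : ℝ) ≤ n := by exact_mod_cast hn1
    have hδ0 : 0 < δ n := lt_of_le_of_lt (by positivity) hδn
    have hk' : k n ≤ n ^ d := (Nat.lt_two_pow_self).le.trans hkn
    have hCn := hC n
    have hMn := hM n
    have hEMn := hEM n
    have hpn := hp n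
    generalize C n = C' at hCn hpn
    generalize s n = s' at hCn hMn hEMn
    have hk1 := hk_pos n
    generalize k n = k' at *
    obtain ⟨m, rfl⟩ : ∃ m, k' = m + 1 := ⟨k' - 1, by omega⟩
    obtain ⟨hτ1, B, ⟨B', hB', hBB'⟩, hle⟩ := HelpBits.exists_predictor_of_help L (D n) (δ n) s' C'
      hCn hpn hMn hEMn (100 * n ^ (d + c))
    refine ⟨B', hB'.trans ?_, ?_⟩
    · simp only [q, Polynomial.eval_add, Polynomial.eval_mul, Polynomial.eval_pow,
        Polynomial.eval_X, Polynomial.eval_one, Polynomial.eval_ofNat]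
      have : m * (p.eval n + 2 + 2) ≤ n ^ d * (p.eval n + 4) :=
        Nat.mul_le_mul (by omega) le_rfl
      gcongr ?_ + 1
      refine Nat.mul_le_mul le_rfl ?_
      omega
    · simp only [hBB']
      refine (HelpBits.half_add_le hδ0 ?_ hτ1).trans hle
      have h1 : 1 ≤ δ n * (n : ℝ) ^ c := by
        rw [div_lt_iff₀ (by positivity)] at hδn
        exact hδn.le
      have h2 : (2 : ℝ) ^ m ≤ (n : ℝ) ^ d := by
        have : 2 ^ m ≤ n ^ d := (Nat.pow_le_pow_right two_pos (Nat.le_succ m)).trans hkn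
        exact_mod_cast this
      calc (100 : ℝ) * 2 ^ m ≤ 100 * (n : ℝ) ^ d * 1 := by linarith
        _ ≤ 100 * (n : ℝ) ^ d * (δ n * (n : ℝ) ^ c) := by gcongr
        _ = _ := by push_cast; ring
  have hall : ∀ n, ∃ B : HelpBits.Circuit (Fin n) Unit, (N ≤ n → B.size ≤ q.eval n) ∧
      1 / 2 + δ n ≤ (D n).real {x | B.eval x () = HelpBits.answer L x} := by
    intro n
    by_cases hn : N ≤ n
    · obtain ⟨B, hB, hle⟩ := hlarge n hn
      exact ⟨B, fun _ => hB, hle⟩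
    -- For the finitely many small `n`, an exact circuit works because 1/2 + δ < 1; its size goes
    -- into the constant term of the final polynomial.
    · obtain ⟨t, B, -, hB⟩ := HelpBits.exists_sizeLE (fun x : Fin n → Bool => HelpBits.answer L x)
      refine ⟨B, fun h => absurd h hn, ?_⟩
      simp only [hB, Set.ofPred_true, probReal_univ]
      linarith [hδ' n]
  choose B hB hle using hall
  refine ⟨B, ⟨q + Polynomial.C (∑ n ∈ Finset.range N, (B n).size), fun n => ?_⟩, hle⟩
  rw [Polynomial.eval_add, Polynomial.eval_C]
  by_cases hn : N ≤ n
  · exact (hB n hn).trans (Nat.le_add_right _ _)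
  · refine le_trans ?_ (Nat.le_add_left _ _)
    exact Finset.single_le_sum (f := fun n => (B n).size) (fun _ _ => Nat.zero_le _)
      (Finset.mem_range.2 (not_le.1 hn))
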